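/- For a positive integer $n$ and $f:[-1,1]\to\mathbb R$ let $x_k=\cos\big(\frac{\pi(k+1/2)}{n+1}\big)$, $k=0,\dots,n$, let $T_j$ be the Chebyshev polynomials of the first kind ($T_0=1$, $T_1(x)=x$, $T_{j+1}(x)=2xT_j(x)-T_{j-1}(x)$), and let $c_0=\frac1{n+1}\sum_{k=0}^n f(x_k)T_0(x_k)$ and $c_j=\frac2{n+1}\sum_{k=0}^n f(x_k)T_j(x_k)$ for $1\le j\le n$ be the coefficients of the degree-$n$ Chebyshev approximation $\sum_{j=0}^n c_jT_j$ of $f$. Let $\varepsilon,\zeta\in(0,1)$, $\delta\in(0,1/2)$, and let $B\in\mathbb R^{d\times d}$ be a (symmetric) positive definite matrix with all eigenvalues in $[\delta,1-\delta]$. Let $m,n$ be natural numbers with $$m\ \ge\ 54\,\varepsilon^{-2}\log\Big(\frac2\zeta\Big),\qquad n\ \ge\ N(\varepsilon,\delta):=\frac{\log\left(\frac{20}{\varepsilon}\left(\sqrt{\frac2\delta-1}-1\right)\frac{\log\left(2(1/\delta-1)\right)}{\log\left(1/(1-\delta)\right)}\right)}{\log\left(\frac{\sqrt{2-\delta}+\sqrt\delta}{\sqrt{2-\delta}-\sqrt\delta}\right)}.$$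 Let $c_0,\dots,c_n$ be the Chebyshev coefficients of $f(x)=\log\big(1-\frac{(1-2\delta)x+1}{2}\big)$, let $A=I-B$ and $X=\frac{1}{1-2\delta}(2A-I)$ (whose eigenvalues lie in $[-1,1]$). Draw independent Rademacher vectors $v_1,\dots,v_m\in\{\pm1\}^d$ (all $md$ coordinates independent and uniform on $\{\pm1\}$); for each $i$ compute $w_0=v_i$, $w_1=Xv_i$, $w_{j+1}=2Xw_j-w_{j-1}$, and $u_i=\sum_{j=0}^n c_jw_j$; output $\Gamma=\frac1m\sum_{i=1}^m v_i^\top u_i$. Then $$\Pr\big[\,|\log\det B-\Gamma|\le\varepsilon\,|\log\det B|\,\big]\ \ge\ 1-\zeta .$$ Moreover $N(\varepsilon,\delta)=O\big(\sqrt{1/\delta}\,\log\frac1{\varepsilon\delta}\big)$: there is an absolute constant $C>0$ with $|N(\varepsilon,\delta)|\le C\sqrt{1/\delta}\,\log\frac1{\varepsilon\delta}$ for all $\varepsilon\in(0,1)$, $\delta\in(0,1/2)$. -/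

import Mathlib

open MeasureTheory ProbabilityTheory

noncomputable section

/-- The `k`-th node `cos (π (k + 1/2) / (n + 1))`, `k = 0, …, n`, of the degree-`n`
Chebyshev approximation. -/
def chebNode (n k : ℕ) : ℝ :=
  Real.cos (Real.pi * ((k : ℝ) + 1 / 2) / ((n : ℝ) + 1))

/-- The `i`-th coefficient `c_i` of the degree-`n` Chebyshev approximation
`p_n(x) = ∑_{j=0}^n c_j T_j(x)` of `f : [-1,1] → ℝ`. -/
def chebCoeff (f : ℝ → ℝ) (n i : ℕ) : ℝ :=
  (if i = 0 then 1 else 2) / ((n : ℝ) + 1) *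
    ∑ k ∈ Finset.range (n + 1),
      f (chebNode n k) * (Polynomial.Chebyshev.T ℝ (i : ℤ)).eval (chebNode n k)

/-- `x ↦ log (1 - x)` on `[δ, 1 - δ]`, transported to `[-1, 1]` by the affine map
`g x = ((1 - 2δ) x + 1) / 2`. -/
def scaledLog (δ x : ℝ) : ℝ :=
  Real.log (1 - ((1 - 2 * δ) * x + 1) / 2)

/-- The matrix `g⁻¹(A) = (2A - I) / (1 - 2δ)` with `A = I - B`; the eigenvalues of `B` lie in
`[δ, 1 - δ]` exactly when those of this matrix lie in `[-1, 1]`. -/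
def scaledMatrix {d : ℕ} (δ : ℝ) (B : Matrix (Fin d) (Fin d) ℝ) : Matrix (Fin d) (Fin d) ℝ :=
  (1 / (1 - 2 * δ)) • ((2 : ℝ) • (1 - B) - 1)

/-- The vectors `w_j` of the three-term recursion
`w_0 = v`, `w_1 = X v`, `w_{j+2} = 2 X w_{j+1} - w_j`. -/
def chebVec {d : ℕ} (X : Matrix (Fin d) (Fin d) ℝ) (v : Fin d → ℝ) : ℕ → Fin d → ℝ
  | 0 => v
  | 1 => X.mulVec v
  | j + 2 => (2 : ℝ) • X.mulVec (chebVec X v (j + 1)) - chebVec X v j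

/-- The output `Γ` of the algorithm on input `B`, `δ`, degree `n` and sampling number `m`, when
the drawn sample vectors are `v 0, …, v (m - 1)`:
`Γ = ∑_i v_iᵀ u_i / m` with `u_i = ∑_{j=0}^n c_j w_j`. -/
def logDetEstimate {d : ℕ} (δ : ℝ) (B : Matrix (Fin d) (Fin d) ℝ) (n m : ℕ)
    (v : Fin m → Fin d → ℝ) : ℝ :=
  ∑ i : Fin m,
    dotProduct (v i)
      (∑ j ∈ Finset.range (n + 1),
        chebCoeff (scaledLog δ) n j • chebVec (scaledMatrix δ B) (v i) j) / (m : ℝ)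

/-- `v 0, …, v (m - 1)` are independent Rademacher random vectors in `ℝ^d`: all `m * d`
coordinates are mutually independent and uniform on `{1, -1}`. -/
def IsRademacherSample {Ω : Type*} [MeasurableSpace Ω] (μ : Measure Ω) {m d : ℕ}
    (v : Fin m → Ω → Fin d → ℝ) : Prop :=
  (∀ i k, Measurable fun ω => v i ω k) ∧
  iIndepFun (fun (p : Fin m × Fin d) ω => v p.1 ω p.2) μ ∧
  ∀ i k, μ {ω | v i ω k = 1} = 1 / 2 ∧ μ {ω | v i ω k = -1} = 1 / 2

/-- The explicit lower bound on the polynomial degree. -/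
def degreeThreshold (ε δ : ℝ) : ℝ :=
  Real.log (20 / ε * (Real.sqrt (2 / δ - 1) - 1) *
      (Real.log (2 * (1 / δ - 1)) / Real.log (1 / (1 - δ)))) /
    Real.log ((Real.sqrt (2 - δ) + Real.sqrt δ) / (Real.sqrt (2 - δ) - Real.sqrt δ))

end

/-! Since `log det B = tr log B`, and `scaledLog δ` takes each eigenvalue of `X` to the log of the
matching eigenvalue of `B`, `Γ` is Hutchinson's estimator for the trace of `p_n(X)`, with `p_n` the
Chebyshev approximation of `scaledLog δ`. Two errors must be controlled relative to `|log det B|`.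

Approximation: the Chebyshev series of `scaledLog δ` is explicit and geometric (`hasSum_scaledLog`).
Interpolation reproduces `T_j` for `j ≤ n` and, by aliasing, sends every other `T_j` to a function
bounded by one, so the error is at most twice the coefficient tail. The degree threshold makes it at
most `(ε/6) log (1/(1-δ))`. As every eigenvalue `l` of `B` has `-log l ≥ log (1/(1-δ))`, this is a
relative error, and it forces `-p_n(X)` to be positive definite.

Sampling: in an eigenbasis the quadratic form is a positive combination of squares of Rademacher
sums. Jensen reduces its mgf to that of one square, bounded by the Gaussian one for the upper tail
and through fourth moments for the lower tail. Chernoff gives `IsRademacherSample.trace_estimator`,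
applied with relative accuracy `ε/3`; `abs_log_det_sub_le` adds up the errors. -/

/-! ### Chebyshev interpolation and the series of the scaled logarithm -/

section Chebyshev

open Polynomial.Chebyshev

/-- The degree-`n` Chebyshev approximation of `f`. -/
noncomputable def chebInterp (f : ℝ → ℝ) (n : ℕ) (x : ℝ) : ℝ :=
  ∑ j ∈ Finset.range (n + 1), chebCoeff f n j * (T ℝ (j : ℤ)).eval x

lemma abs_chebNode_le_one (n k : ℕ) : |chebNode n k| ≤ 1 := Real.abs_cos_le_one _

lemma chebCoeff_congr {f g : ℝ → ℝ} {n : ℕ} (h : ∀ k, f (chebNode n k) = g (chebNode n k))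
    (i : ℕ) : chebCoeff f n i = chebCoeff g n i := by
  simp only [chebCoeff, h]

lemma chebInterp_congr {f g : ℝ → ℝ} {n : ℕ} (h : ∀ k, f (chebNode n k) = g (chebNode n k))
    (x : ℝ) : chebInterp f n x = chebInterp g n x := by
  simp only [chebInterp, chebCoeff_congr h]

lemma chebInterp_neg (f : ℝ → ℝ) (n : ℕ) (x : ℝ) :
    chebInterp (fun y => -f y) n x = -chebInterp f n x := by
  simp [chebInterp, chebCoeff]

lemma hasSum_chebInterp {f : ℝ → ℝ} {g : ℕ → ℝ → ℝ} {n : ℕ}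
    (h : ∀ k, HasSum (fun j => g j (chebNode n k)) (f (chebNode n k))) (x : ℝ) :
    HasSum (fun j => chebInterp (g j) n x) (chebInterp f n x) := by
  refine hasSum_sum fun i _ => HasSum.mul_right _ (HasSum.mul_left _ ?_)
  exact hasSum_sum fun k _ => (h k).mul_right _

lemma sum_eval_T_chebNode {n : ℕ} {m : ℤ} (hm : ¬ (2 * ((n + 1 : ℕ) : ℤ)) ∣ m) :
    ∑ k ∈ Finset.range (n + 1), (T ℝ m).eval (chebNode n k) = 0 := by
  have h := sumZeroes_T_of_not_dvd hm
  rw [sumZeroes] at h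
  have hpi : Real.pi / ((n + 1 : ℕ) : ℝ) ≠ 0 := by positivity
  rw [← (mul_eq_zero_iff_left hpi).1 h]
  refine Finset.sum_congr rfl fun k _ => ?_
  rw [chebNode]
  congr 2
  push_cast
  field_simp

/-- Discrete orthogonality: the product formula leaves node sums of `T_{i+j}` and `T_{i-j}`, which
vanish unless the index is a multiple of `2(n+1)`; for `i, j ≤ n` only index `0` is such a multiple.
-/
lemma chebCoeff_T {n i j : ℕ} (hi : i ≤ n) (hj : j ≤ n) :
    chebCoeff (fun x => (T ℝ (i : ℤ)).eval x) n j = if j = i then 1 else 0 := by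
  have key : ∀ x : ℝ, (T ℝ (i : ℤ)).eval x * (T ℝ (j : ℤ)).eval x =
      ((T ℝ ((i : ℤ) + j)).eval x + (T ℝ ((i : ℤ) - j)).eval x) / 2 := by
    intro x
    have := congrArg (Polynomial.eval x) (T_mul_T ℝ (i : ℤ) j)
    simp only [Polynomial.eval_mul, Polynomial.eval_add, Polynomial.eval_ofNat] at this
    linarith
  have hn : ((n : ℝ) + 1) ≠ 0 := by positivity
  simp only [chebCoeff, key, ← Finset.sum_div, Finset.sum_add_distrib]
  by_cases hij : j = i
  · subst hij
    rcases Nat.eq_zero_or_pos j with rfl | hpos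
    · simp [hn]
    · rw [sum_eval_T_chebNode]
      · simp [hpos.ne', hn]
      · intro hd
        have := Int.le_of_dvd (by omega) hd
        omega
  · rw [sum_eval_T_chebNode, sum_eval_T_chebNode]
    · simp [hij]
    · intro hd
      have h0 : (0 : ℤ) < |(i : ℤ) - j| := abs_pos.2 (by omega)
      have := Int.le_of_dvd h0 ((dvd_abs _ _).2 hd)
      rcases abs_cases ((i : ℤ) - j) with h | h <;> omega
    · intro hd
      have := Int.le_of_dvd (by omega) hd
      omega

lemma chebInterp_T_of_le {n i : ℕ} (hi : i ≤ n) (x : ℝ) :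
    chebInterp (fun y => (T ℝ (i : ℤ)).eval y) n x = (T ℝ (i : ℤ)).eval x := by
  rw [chebInterp, Finset.sum_congr rfl fun j hj => by
    rw [chebCoeff_T hi (Nat.lt_succ_iff.1 (Finset.mem_range.1 hj))]]
  simp [Nat.lt_succ_iff.2 hi]

/-- Aliasing at the Chebyshev nodes. -/
lemma eval_T_chebNode_reflect (n k : ℕ) (i : ℤ) :
    (T ℝ (2 * (n + 1) - i)).eval (chebNode n k) = -(T ℝ i).eval (chebNode n k) := by
  rw [chebNode, T_real_cos, T_real_cos, ← Real.cos_pi_sub]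
  have hn : ((n : ℝ) + 1) ≠ 0 := by positivity
  -- With `θ` the node angle, `2(n+1)θ = (2k+1)π`; the shift by `k` full turns removes `2kπ`.
  rw [← Real.cos_add_nat_mul_two_pi (Real.pi - _) k]
  congr 1
  push_cast
  field_simp
  ring

/-- Reflection `j ↦ |2(n+1) - j|` only changes the sign of the interpolant and strictly lowers an
index above `n+1`, so it descends to an index `≤ n`, where interpolation is exact, or to the fixed
point `n+1`. -/
lemma abs_chebInterp_T_le_one (n j : ℕ) {x : ℝ} (hx : |x| ≤ 1) :
    |chebInterp (fun y => (T ℝ (j : ℤ)).eval y) n x| ≤ 1 := by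
  induction j using Nat.strong_induction_on with
  | _ j ih =>
    rcases le_or_gt j n with hj | hj
    · rw [chebInterp_T_of_le hj]
      exact abs_eval_T_real_le_one _ hx
    · have hr : chebInterp (fun y => (T ℝ (j : ℤ)).eval y) n x =
          -chebInterp (fun y => (T ℝ (2 * (n + 1) - j : ℤ)).eval y) n x := by
        rw [← chebInterp_neg]
        refine chebInterp_congr (fun k => ?_) x
        rw [eval_T_chebNode_reflect, neg_neg]
      -- At `j = n+1` the interpolant equals its own negative, hence is zero.
      rcases (Nat.succ_le_of_lt hj).eq_or_lt with h | h
      · have hj' : (2 * (n + 1) - j : ℤ) = j := by omega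
        rw [hj'] at hr
        have : chebInterp (fun y => (T ℝ (j : ℤ)).eval y) n x = 0 := by linarith
        simp [this]
      · have e : T ℝ (2 * (n + 1) - j : ℤ) = T ℝ (((2 * (n + 1) - j : ℤ).natAbs : ℕ) : ℤ) := by
          rw [T_natAbs]
        rw [hr, abs_neg, e]
        exact ih _ (by omega)

/-- Error of the Chebyshev approximation of a function with geometrically decaying Chebyshev
coefficients. -/
lemma abs_sub_chebInterp_le {f : ℝ → ℝ} {a : ℕ → ℝ} {n : ℕ} {r M x : ℝ} (hx : |x| ≤ 1)
    (hr0 : 0 ≤ r) (hr1 : r < 1) (ha : ∀ j, n < j → |a j| ≤ M * r ^ j)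
    (hf : ∀ y, |y| ≤ 1 → HasSum (fun j : ℕ => a j * (T ℝ (j : ℤ)).eval y) (f y)) :
    |f x - chebInterp f n x| ≤ 2 * M * r ^ (n + 1) / (1 - r) := by
  have h1 := (hf x hx).sub (hasSum_chebInterp
    (g := fun j y => a j * (T ℝ (j : ℤ)).eval y) (fun k => hf _ (abs_chebNode_le_one n k)) x)
  have h2 : ∀ j : ℕ, chebInterp (fun y => a j * (T ℝ (j : ℤ)).eval y) n x =
      a j * chebInterp (fun y => (T ℝ (j : ℤ)).eval y) n x := by
    intro j
    simp only [chebInterp, chebCoeff, Finset.mul_sum, Finset.sum_mul]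
    exact Finset.sum_congr rfl fun _ _ => Finset.sum_congr rfl fun _ _ => by ring
  simp only [h2, ← mul_sub] at h1
  have h3 := (hasSum_nat_add_iff' (n + 1)).2 h1
  -- The terms `j ≤ n` cancel exactly; each later one costs `|T_j|` plus its interpolant, at most
  -- `2`.
  rw [Finset.sum_eq_zero, sub_zero] at h3
  · have hg : HasSum (fun j : ℕ => 2 * M * r ^ (n + 1) * r ^ j)
        (2 * M * r ^ (n + 1) / (1 - r)) := by
      rw [div_eq_mul_inv]
      exact (hasSum_geometric_of_lt_one hr0 hr1).mul_left _
    rw [← h3.tsum_eq, ← Real.norm_eq_abs]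
    refine tsum_of_norm_bounded hg fun j => ?_
    rw [Real.norm_eq_abs, abs_mul]
    have ha' := ha (j + (n + 1)) (by omega)
    have hT := abs_eval_T_real_le_one ((j + (n + 1) : ℕ) : ℤ) hx
    have hI := abs_chebInterp_T_le_one n (j + (n + 1)) hx
    calc _ ≤ (M * r ^ (j + (n + 1))) * 2 := by
          refine mul_le_mul ha' ?_ (abs_nonneg _) ((abs_nonneg _).trans ha')
          exact (abs_sub _ _).trans (by linarith)
      _ = _ := by ring
  · intro j hj
    rw [chebInterp_T_of_le (Nat.lt_succ_iff.1 (Finset.mem_range.1 hj))]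
    simp

/-- Real part of the Taylor series of `-log (1 - z)` at `z = r e^{iθ}`, using `|1 - z|² = 1 - 2r cos
θ + r²`. -/
lemma hasSum_log_one_sub_two_mul_cos {r : ℝ} (hr0 : 0 ≤ r) (hr1 : r < 1) (θ : ℝ) :
    HasSum (fun j : ℕ => -2 * r ^ j / j * Real.cos (j * θ))
      (Real.log (1 - 2 * r * Real.cos θ + r ^ 2)) := by
  set z : ℂ := r * Complex.exp (θ * Complex.I) with hz
  have hzn : ‖z‖ = r := by
    rw [hz, norm_mul, Complex.norm_exp_ofReal_mul_I, Complex.norm_real, Real.norm_of_nonneg hr0,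
      mul_one]
  have h := (Complex.hasSum_re (Complex.hasSum_taylorSeries_neg_log (hzn ▸ hr1))).mul_left (-2)
  have hlog : -2 * (-Complex.log (1 - z)).re = Real.log (1 - 2 * r * Real.cos θ + r ^ 2) := by
    have hsq : 1 - 2 * r * Real.cos θ + r ^ 2 = ‖1 - z‖ ^ 2 := by
      rw [← Complex.normSq_eq_norm_sq, Complex.normSq_apply]
      simp only [hz, Complex.sub_re, Complex.one_re, Complex.re_ofReal_mul,
        Complex.exp_ofReal_mul_I_re, Complex.sub_im, Complex.one_im, Complex.im_ofReal_mul,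
        Complex.exp_ofReal_mul_I_im]
      linear_combination -r ^ 2 * Real.sin_sq_add_cos_sq θ
    rw [hsq, Real.log_pow, Complex.neg_re, Complex.log_re]
    push_cast
    ring
  rw [hlog] at h
  convert! h using 2 with j
  have : z ^ j / (j : ℂ) = ((r ^ j / j : ℝ) : ℂ) * Complex.exp ((j * θ : ℝ) * Complex.I) := by
    rw [hz, mul_pow, ← Complex.exp_nat_mul]
    push_cast
    ring_nf
  rw [this, Complex.re_ofReal_mul, Complex.exp_ofReal_mul_I_re]
  ring

/-- The Chebyshev series of `scaledLog δ`. -/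
lemma hasSum_scaledLog {δ x : ℝ} (hδ : δ ∈ Set.Ioo (0 : ℝ) (1 / 2)) (hx : |x| ≤ 1) :
    HasSum (fun j : ℕ => (if j = 0 then Real.log ((√(1 - δ) + √δ) ^ 2 / 4) else
        -2 * ((√(1 - δ) - √δ) / (√(1 - δ) + √δ)) ^ j / j) * (T ℝ (j : ℤ)).eval x)
      (scaledLog δ x) := by
  obtain ⟨h0, h1⟩ := hδ
  set s := √(1 - δ)
  set t := √δ
  have ht : 0 < t := Real.sqrt_pos.2 h0
  have hts : t < s := Real.sqrt_lt_sqrt h0.le (by linarith)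
  have hs2 : s ^ 2 = 1 - δ := Real.sq_sqrt (by linarith)
  have ht2 : t ^ 2 = δ := Real.sq_sqrt h0.le
  have hst : 0 < s + t := by linarith
  set r := (s - t) / (s + t) with hr
  have hr0 : 0 ≤ r := div_nonneg (by linarith) hst.le
  have hr1 : r < 1 := by rw [hr, div_lt_one hst]; linarith
  obtain ⟨hx1, hx2⟩ := abs_le.1 hx
  have hxc : Real.cos (Real.arccos x) = x := Real.cos_arccos hx1 hx2
  have hlog := hasSum_log_one_sub_two_mul_cos hr0 hr1 (Real.arccos x)
  rw [hxc] at hlog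
  have hpos : 0 < 1 - 2 * r * x + r ^ 2 := by nlinarith [sq_nonneg (1 - r)]
  -- The choice of `r` makes this factorization work, since `s² + t² = 1` and `s² - t² = 1 - 2δ`.
  have heq : scaledLog δ x = Real.log ((s + t) ^ 2 / 4) + Real.log (1 - 2 * r * x + r ^ 2) := by
    rw [← Real.log_mul (by positivity) hpos.ne', scaledLog]
    congr 1
    rw [hr]
    field_simp
    nlinarith
  rw [heq]
  -- At `j = 0` the logarithmic series contributes `0`, division by zero being zero, so the constant
  -- fits there.
  convert! (hasSum_ite_eq (0 : ℕ) (Real.log ((s + t) ^ 2 / 4))).add hlog using 2 with j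
  rcases eq_or_ne j 0 with rfl | hj
  · simp
  · have : (T ℝ (j : ℤ)).eval x = Real.cos (j * Real.arccos x) := by
      conv_lhs => rw [← hxc]
      rw [T_real_cos]
      norm_cast
    simp [hj, this]

lemma abs_scaledLog_sub_chebInterp_le {δ x : ℝ} (hδ : δ ∈ Set.Ioo (0 : ℝ) (1 / 2))
    (hx : |x| ≤ 1) (n : ℕ) :
    |scaledLog δ x - chebInterp (scaledLog δ) n x| ≤
      4 * ((√(1 - δ) - √δ) / (√(1 - δ) + √δ)) ^ (n + 1) /
        (1 - (√(1 - δ) - √δ) / (√(1 - δ) + √δ)) := by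
  have ht : 0 < √δ := Real.sqrt_pos.2 hδ.1
  have hts : √δ < √(1 - δ) := Real.sqrt_lt_sqrt hδ.1.le (by linarith [hδ.2])
  have hst : 0 < √(1 - δ) + √δ := by linarith
  have hr0 : 0 ≤ (√(1 - δ) - √δ) / (√(1 - δ) + √δ) := div_nonneg (by linarith) hst.le
  have hr1 : (√(1 - δ) - √δ) / (√(1 - δ) + √δ) < 1 := by rw [div_lt_one hst]; linarith
  have := abs_sub_chebInterp_le (n := n) (M := 2) hx hr0 hr1 ?_
    (fun y hy => hasSum_scaledLog hδ hy)
  · convert! this using 3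
    norm_num
  · intro j hj
    have hj0 : j ≠ 0 := by omega
    have hj1 : (1 : ℝ) ≤ j := by exact_mod_cast Nat.one_le_iff_ne_zero.2 hj0
    rw [if_neg hj0, abs_div, abs_mul, abs_of_nonneg (pow_nonneg hr0 j), Nat.abs_cast, abs_neg,
      abs_two]
    exact div_le_self (by positivity) hj1

end Chebyshev

/-! ### The degree threshold: size and resulting accuracy -/

section Threshold

lemma log_two_le_log_mul {δ : ℝ} (hδ : δ ∈ Set.Ioo (0 : ℝ) (1 / 2)) :
    Real.log 2 ≤ Real.log (2 * (1 / δ - 1)) := by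
  have h2 : 2 < 1 / δ := by rw [lt_div_iff₀ hδ.1]; linarith [hδ.2]
  exact Real.log_le_log (by norm_num) (by linarith)

lemma le_log_one_div_one_sub {δ : ℝ} (hδ : δ ∈ Set.Ioo (0 : ℝ) (1 / 2)) :
    δ ≤ Real.log (1 / (1 - δ)) := by
  rw [one_div, Real.log_inv]
  linarith [Real.log_le_sub_one_of_pos (show 0 < 1 - δ by linarith [hδ.2])]

lemma log_one_div_one_sub_le {δ : ℝ} (hδ : δ ∈ Set.Ioo (0 : ℝ) (1 / 2)) :
    Real.log (1 / (1 - δ)) ≤ Real.log 2 := by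
  have h : 0 < 1 - δ := by linarith [hδ.2]
  refine Real.log_le_log (by positivity) ?_
  rw [div_le_iff₀ h]
  linarith [hδ.2]

lemma sqrt_two_div_sub_one {δ : ℝ} (hδ : δ ∈ Set.Ioo (0 : ℝ) (1 / 2)) :
    √(2 / δ - 1) = √(2 - δ) / √δ := by
  rw [← Real.sqrt_div (by linarith [hδ.2])]
  congr 1
  have := hδ.1.ne'
  field_simp

lemma seventeen_div_ten_le_sqrt {δ : ℝ} (hδ : δ ∈ Set.Ioo (0 : ℝ) (1 / 2)) :
    17 / 10 ≤ √(2 / δ - 1) := by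
  refine Real.le_sqrt_of_sq_le ?_
  have : 4 ≤ 2 / δ := by rw [le_div_iff₀ hδ.1]; linarith [hδ.2]
  linarith

/-- The argument of the logarithm in the numerator of `degreeThreshold`. -/
noncomputable def thresholdArg (ε δ : ℝ) : ℝ :=
  20 / ε * (√(2 / δ - 1) - 1) * (Real.log (2 * (1 / δ - 1)) / Real.log (1 / (1 - δ)))

lemma one_le_thresholdArg {ε δ : ℝ} (hε : ε ∈ Set.Ioo (0 : ℝ) 1)
    (hδ : δ ∈ Set.Ioo (0 : ℝ) (1 / 2)) : 1 ≤ thresholdArg ε δ := by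
  have hL : 0 < Real.log (1 / (1 - δ)) := hδ.1.trans_le (le_log_one_div_one_sub hδ)
  have h1 : 20 ≤ 20 / ε := le_div_self (by norm_num) hε.1 hε.2.le
  have h2 := seventeen_div_ten_le_sqrt hδ
  have h3 : 1 ≤ Real.log (2 * (1 / δ - 1)) / Real.log (1 / (1 - δ)) := by
    rw [one_le_div hL]
    exact (log_one_div_one_sub_le hδ).trans (log_two_le_log_mul hδ)
  have h4 : 1 ≤ 20 / ε * (√(2 / δ - 1) - 1) := by nlinarith
  exact one_le_mul_of_one_le_of_one_le h4 h3

/-- Any polynomial bound in `1/(εδ)` suffices. As `1/(εδ) > 2`, the numerical constant is absorbed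
into further powers; the exponent `10` becomes the absolute constant of the theorem. -/
lemma thresholdArg_le {ε δ : ℝ} (hε : ε ∈ Set.Ioo (0 : ℝ) 1)
    (hδ : δ ∈ Set.Ioo (0 : ℝ) (1 / 2)) : thresholdArg ε δ ≤ (1 / (ε * δ)) ^ 10 := by
  have hd := hδ.1
  have he := hε.1
  have h2 : 2 < 1 / δ := by rw [lt_div_iff₀ hδ.1]; linarith [hδ.2]
  have h1e : 1 ≤ 1 / ε := by rw [le_div_iff₀ he]; linarith [hε.2]
  have hsq : √(2 / δ - 1) - 1 ≤ 2 / δ := by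
    have : √(2 / δ - 1) ≤ 2 / δ := by
      refine Real.sqrt_le_iff.2 ⟨by positivity, ?_⟩
      have : 2 / δ = 2 * (1 / δ) := by ring
      nlinarith
    linarith
  have hsq0 : 0 ≤ √(2 / δ - 1) - 1 := by linarith [seventeen_div_ten_le_sqrt hδ]
  have hU : Real.log (2 * (1 / δ - 1)) ≤ 2 / δ := by
    have h := Real.log_le_sub_one_of_pos (show 0 < 2 * (1 / δ - 1) by linarith)
    have : 2 / δ = 2 * (1 / δ) := by ring
    linarith
  have hU0 : 0 ≤ Real.log (2 * (1 / δ - 1)) :=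
    (Real.log_nonneg (by norm_num)).trans (log_two_le_log_mul hδ)
  have hL := le_log_one_div_one_sub hδ
  have hx : 2 < 1 / (ε * δ) := by
    rw [lt_div_iff₀ (mul_pos he hd)]
    linarith [mul_lt_of_lt_one_left hd hε.2, hδ.2]
  calc thresholdArg ε δ ≤ 20 / ε * (2 / δ) * ((2 / δ) / δ) := by
        rw [thresholdArg]
        have := div_nonneg hU0 (hd.le.trans hL)
        gcongr
    _ = 80 * (1 / ε * (1 / δ) ^ 3) := by field_simp; ring
    _ ≤ 2 ^ 7 * (1 / (ε * δ)) ^ 3 := by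
        rw [one_div (ε * δ), mul_inv, ← one_div, ← one_div, mul_pow]
        gcongr
        · norm_num
        · exact le_self_pow₀ h1e (by norm_num)
    _ ≤ (1 / (ε * δ)) ^ 7 * (1 / (ε * δ)) ^ 3 := by gcongr
    _ = _ := by rw [← pow_add]

/-- The base of the geometric convergence rate. -/
noncomputable def chebRate (δ : ℝ) : ℝ := (√(2 - δ) + √δ) / (√(2 - δ) - √δ)

lemma degreeThreshold_eq (ε δ : ℝ) :
    degreeThreshold ε δ = Real.log (thresholdArg ε δ) / Real.log (chebRate δ) := rfl

lemma sqrt_lt_sqrt_two_sub {δ : ℝ} (hδ : δ ∈ Set.Ioo (0 : ℝ) (1 / 2)) : √δ < √(2 - δ) :=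
  Real.sqrt_lt_sqrt hδ.1.le (by linarith [hδ.2])

lemma one_lt_chebRate {δ : ℝ} (hδ : δ ∈ Set.Ioo (0 : ℝ) (1 / 2)) : 1 < chebRate δ := by
  have h := sqrt_lt_sqrt_two_sub hδ
  have h0 := Real.sqrt_pos.2 hδ.1
  rw [chebRate, one_lt_div (by linarith)]
  linarith

/-- From `log K ≥ 1 - 1/K = 2√δ / (√(2-δ) + √δ)`; the denominator is at most `2` because the two
squares sum to `2`. -/
lemma sqrt_le_log_chebRate {δ : ℝ} (hδ : δ ∈ Set.Ioo (0 : ℝ) (1 / 2)) :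
    √δ ≤ Real.log (chebRate δ) := by
  have h := sqrt_lt_sqrt_two_sub hδ
  have h0 := Real.sqrt_pos.2 hδ.1
  have hK := one_lt_chebRate hδ
  refine le_trans ?_ (Real.one_sub_inv_le_log_of_pos (by linarith))
  have hs : √(2 - δ) + √δ ≤ 2 := by
    refine abs_le_of_sq_le_sq' ?_ (by norm_num) |>.2
    nlinarith [Real.sq_sqrt hδ.1.le, Real.sq_sqrt (show 0 ≤ 2 - δ by linarith [hδ.2]),
      sq_nonneg (√(2 - δ) - √δ)]
  rw [chebRate, inv_div, one_sub_div (by linarith), le_div_iff₀ (by linarith)]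
  nlinarith

lemma abs_degreeThreshold_le {ε δ : ℝ} (hε : ε ∈ Set.Ioo (0 : ℝ) 1)
    (hδ : δ ∈ Set.Ioo (0 : ℝ) (1 / 2)) :
    |degreeThreshold ε δ| ≤ 10 * (√(1 / δ) * Real.log (1 / (ε * δ))) := by
  have h0 := Real.sqrt_pos.2 hδ.1
  have hA := one_le_thresholdArg hε hδ
  have hlog : Real.log (thresholdArg ε δ) ≤ 10 * Real.log (1 / (ε * δ)) := by
    have := Real.log_le_log (by linarith) (thresholdArg_le hε hδ)
    rwa [Real.log_pow] at this
  rw [degreeThreshold_eq, abs_of_nonneg (div_nonneg (Real.log_nonneg hA)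
    (Real.log_nonneg (one_lt_chebRate hδ).le))]
  calc _ ≤ (10 * Real.log (1 / (ε * δ))) / √δ :=
        div_le_div₀ ((Real.log_nonneg hA).trans hlog) hlog h0 (sqrt_le_log_chebRate hδ)
    _ = _ := by rw [Real.sqrt_div zero_le_one, Real.sqrt_one]; ring

lemma thresholdArg_le_chebRate_pow {ε δ : ℝ} (hε : ε ∈ Set.Ioo (0 : ℝ) 1)
    (hδ : δ ∈ Set.Ioo (0 : ℝ) (1 / 2)) {n : ℕ} (hn : degreeThreshold ε δ ≤ n) :
    thresholdArg ε δ ≤ chebRate δ ^ n := by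
  have hK := one_lt_chebRate hδ
  have hA := one_le_thresholdArg hε hδ
  rw [degreeThreshold_eq, div_le_iff₀ (Real.log_pos hK), ← Real.log_pow] at hn
  exact (Real.log_le_log_iff (by linarith) (by positivity)).1 hn

/-- With `K` the rate, the geometric tail `4K⁻⁽ⁿ⁺¹⁾ / (1 - K⁻¹)` is `4K⁻ⁿ / (K - 1)`; this accounts
for the square-root factor in the threshold. -/
lemma chebRate_sub_one_inv {δ : ℝ} (hδ : δ ∈ Set.Ioo (0 : ℝ) (1 / 2)) :
    (chebRate δ - 1)⁻¹ = (√(2 / δ - 1) - 1) / 2 := by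
  have h := sqrt_lt_sqrt_two_sub hδ
  have h0 := Real.sqrt_pos.2 hδ.1
  have h1 : √(2 - δ) - √δ ≠ 0 := by linarith
  rw [sqrt_two_div_sub_one hδ, chebRate, div_sub_one h1, inv_div, div_sub_one h0.ne', div_div]
  congr 1
  ring

/-- `(a - √δ)/(a + √δ)` increases with `a`: the series decays at least as fast as the threshold
assumes. -/
lemma div_le_chebRate_inv {δ : ℝ} (hδ : δ ∈ Set.Ioo (0 : ℝ) (1 / 2)) :
    (√(1 - δ) - √δ) / (√(1 - δ) + √δ) ≤ (chebRate δ)⁻¹ := by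
  have h := sqrt_lt_sqrt_two_sub hδ
  have h0 := Real.sqrt_pos.2 hδ.1
  have h1 : √(1 - δ) ≤ √(2 - δ) := Real.sqrt_le_sqrt (by linarith)
  have h2 : 0 ≤ √(1 - δ) := Real.sqrt_nonneg _
  rw [chebRate, inv_div, div_le_div_iff₀ (by linarith) (by linarith)]
  nlinarith

/-- At degree at least `degreeThreshold ε δ` the relative approximation error is at most
`ε / 6`. -/
lemma abs_scaledLog_sub_chebInterp_le_of_degreeThreshold_le {ε δ x : ℝ}
    (hε : ε ∈ Set.Ioo (0 : ℝ) 1) (hδ : δ ∈ Set.Ioo (0 : ℝ) (1 / 2)) (hx : |x| ≤ 1) {n : ℕ}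
    (hn : degreeThreshold ε δ ≤ n) :
    |scaledLog δ x - chebInterp (scaledLog δ) n x| ≤ ε / 6 * Real.log (1 / (1 - δ)) := by
  refine (abs_scaledLog_sub_chebInterp_le hδ hx n).trans ?_
  have hs : √δ < √(1 - δ) := Real.sqrt_lt_sqrt hδ.1.le (by linarith [hδ.2])
  have h0 := Real.sqrt_pos.2 hδ.1
  set r := (√(1 - δ) - √δ) / (√(1 - δ) + √δ)
  have hr0 : 0 ≤ r := div_nonneg (by linarith) (by linarith)
  have hrK : r ≤ (chebRate δ)⁻¹ := div_le_chebRate_inv hδ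
  have hK := one_lt_chebRate hδ
  have hK1 : (chebRate δ)⁻¹ < 1 := inv_lt_one_of_one_lt₀ hK
  have hA := thresholdArg_le_chebRate_pow hε hδ hn
  have hA1 := one_le_thresholdArg hε hδ
  set L := Real.log (1 / (1 - δ)) with hLdef
  set U := Real.log (2 * (1 / δ - 1)) with hUdef
  have hL : 0 < L := hδ.1.trans_le (le_log_one_div_one_sub hδ)
  -- The tail will come out as `εL/(10U)`, so `U ≥ log 2 ≥ 0.6` yields the factor `1/6`.
  have hU : 0.6 ≤ U := by
    have := log_two_le_log_mul hδ
    have := Real.log_two_gt_d9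
    linarith
  have hs2 : 0 < √(2 / δ - 1) - 1 := by linarith [seventeen_div_ten_le_sqrt hδ]
  have hε0 := hε.1
  calc 4 * r ^ (n + 1) / (1 - r)
      ≤ 4 * (chebRate δ)⁻¹ ^ (n + 1) / (1 - (chebRate δ)⁻¹) := by
        gcongr
    _ = 4 * (chebRate δ - 1)⁻¹ * (chebRate δ ^ n)⁻¹ := by
        have : chebRate δ - 1 ≠ 0 := by linarith
        have : chebRate δ ≠ 0 := by linarith
        rw [inv_pow, pow_succ]
        field_simp
    _ ≤ 4 * (chebRate δ - 1)⁻¹ * (thresholdArg ε δ)⁻¹ := by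
        have : 0 < chebRate δ - 1 := by linarith
        gcongr
    _ = ε * L / (10 * U) := by
        have : U ≠ 0 := by linarith
        have := hs2.ne'
        rw [chebRate_sub_one_inv hδ, thresholdArg, ← hLdef, ← hUdef]
        field_simp
        norm_num
    _ ≤ ε / 6 * L := by
        rw [div_le_iff₀ (by linarith)]
        nlinarith [mul_pos hε0 hL]

end Threshold

/-! ### Moments and generating functions of Rademacher sums -/

section Rademacher

variable {Ω : Type*} [MeasurableSpace Ω] {μ : Measure Ω} {ι : Type*}

/-- A family of independent Rademacher random variables. -/
structure IsRademacherFamily (μ : Measure Ω) (w : ι → Ω → ℝ) : Prop where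
  measurable : ∀ i, Measurable (w i)
  indep : iIndepFun w μ
  measure_one : ∀ i, μ {ω | w i ω = 1} = 1 / 2
  measure_neg_one : ∀ i, μ {ω | w i ω = -1} = 1 / 2

lemma integrable_comp_of_ae_abs_le [IsFiniteMeasure μ] {S : Ω → ℝ} {F : ℝ → ℝ} {M : ℝ}
    (hS : Measurable S) (hF : Continuous F) (hM : ∀ᵐ ω ∂μ, |S ω| ≤ M) :
    Integrable (fun ω => F (S ω)) μ := by
  obtain ⟨C, hC⟩ := (isCompact_Icc (a := -M) (b := M)).exists_bound_of_continuousOn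
    hF.continuousOn
  refine Integrable.of_bound (hF.measurable.comp hS).aestronglyMeasurable C ?_
  filter_upwards [hM] with ω hω
  exact hC _ (abs_le.1 hω)

namespace IsRademacherFamily

variable {w : ι → Ω → ℝ}

lemma ae_eq_or_eq [IsProbabilityMeasure μ] (h : IsRademacherFamily μ w) (i : ι) :
    ∀ᵐ ω ∂μ, w i ω = 1 ∨ w i ω = -1 := by
  have hm1 : MeasurableSet {ω | w i ω = 1} := h.measurable i (measurableSet_singleton 1)
  have hm2 : MeasurableSet {ω | w i ω = -1} := h.measurable i (measurableSet_singleton (-1))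
  have hd : Disjoint {ω | w i ω = 1} {ω | w i ω = -1} := by
    rw [Set.disjoint_left]
    intro ω h1 h2
    simp only [Set.mem_ofPred_eq] at h1 h2
    linarith
  have hu : μ ({ω | w i ω = 1} ∪ {ω | w i ω = -1}) = 1 := by
    rw [measure_union hd hm2, h.measure_one, h.measure_neg_one, ENNReal.add_halves]
  exact (prob_compl_eq_zero_iff (hm1.union hm2)).2 hu

lemma integral_comp [IsProbabilityMeasure μ] (h : IsRademacherFamily μ w) (i : ι) (g : ℝ → ℝ) :
    ∫ ω, g (w i ω) ∂μ = (g 1 + g (-1)) / 2 := by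
  have hm1 : MeasurableSet {ω | w i ω = 1} := h.measurable i (measurableSet_singleton 1)
  have hm2 : MeasurableSet {ω | w i ω = -1} := h.measurable i (measurableSet_singleton (-1))
  have e : (fun ω => g (w i ω)) =ᵐ[μ] fun ω =>
      Set.indicator {ω | w i ω = 1} (fun _ => g 1) ω +
        Set.indicator {ω | w i ω = -1} (fun _ => g (-1)) ω := by
    filter_upwards [h.ae_eq_or_eq i] with ω hω
    rcases hω with hω | hω <;> simp [Set.indicator, hω] <;> norm_num
  rw [integral_congr_ae e, integral_add ((integrable_const _).indicator hm1)
    ((integrable_const _).indicator hm2), integral_indicator_const _ hm1,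
    integral_indicator_const _ hm2, measureReal_def, measureReal_def, h.measure_one,
    h.measure_neg_one]
  simp
  ring

variable (a : ι → ℝ)

lemma measurable_sum (h : IsRademacherFamily μ w) (T : Finset ι) :
    Measurable fun ω => ∑ k ∈ T, a k * w k ω :=
  Finset.measurable_fun_sum _ fun k _ => (h.measurable k).const_mul _

lemma ae_abs_sum_le [Countable ι] [IsProbabilityMeasure μ] (h : IsRademacherFamily μ w) (T : Finset ι) :
    ∀ᵐ ω ∂μ, |∑ k ∈ T, a k * w k ω| ≤ ∑ k ∈ T, |a k| := by
  filter_upwards [ae_all_iff.2 h.ae_eq_or_eq] with ω hω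
  refine (Finset.abs_sum_le_sum_abs _ _).trans (Finset.sum_le_sum fun k _ => ?_)
  rcases hω k with e | e <;> simp [e]

lemma integrable_comp_sum [Countable ι] [IsProbabilityMeasure μ] (h : IsRademacherFamily μ w) (T : Finset ι)
    {F : ℝ → ℝ} (hF : Continuous F) : Integrable (fun ω => F (∑ k ∈ T, a k * w k ω)) μ :=
  integrable_comp_of_ae_abs_le (h.measurable_sum a T) hF (h.ae_abs_sum_le a T)

/-- Independence factors the expectation into hyperbolic cosines, and `cosh x ≤ exp (x²/2)`. -/
lemma integral_exp_mul_sum_le [Fintype ι] [IsProbabilityMeasure μ] (h : IsRademacherFamily μ w) (c : ℝ) :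
    ∫ ω, Real.exp (c * ∑ k, a k * w k ω) ∂μ ≤ Real.exp (c ^ 2 / 2 * ∑ k, a k ^ 2) := by
  have e : ∀ ω, Real.exp (c * ∑ k, a k * w k ω) = ∏ k, Real.exp (c * a k * w k ω) := by
    intro ω
    rw [← Real.exp_sum, Finset.mul_sum]
    simp only [mul_assoc]
  simp only [e]
  rw [h.indep.integral_fun_prod_comp (f := fun k x => Real.exp (c * a k * x))
    (fun k => (h.measurable k).aemeasurable)
    (fun k => (by fun_prop : Continuous fun x => Real.exp (c * a k * x)).aestronglyMeasurable),
    Finset.mul_sum, Real.exp_sum]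
  refine Finset.prod_le_prod (fun k _ => integral_nonneg fun _ => (Real.exp_pos _).le)
    fun k _ => ?_
  rw [h.integral_comp k fun x => Real.exp (c * a k * x)]
  have := Real.cosh_le_exp_half_sq (c * a k)
  rw [Real.cosh_eq] at this
  convert! this using 2
  · simp
  · ring

lemma integral_mul_comp_sum_eq_zero [Countable ι] [IsProbabilityMeasure μ] (h : IsRademacherFamily μ w)
    {T : Finset ι} {j : ι} (hj : j ∉ T) {F : ℝ → ℝ} (hF : Continuous F) :
    ∫ ω, w j ω * F (∑ k ∈ T, a k * w k ω) ∂μ = 0 := by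
  classical
  have hφ : Measurable fun x : ({j} : Finset ι) → ℝ => x ⟨j, Finset.mem_singleton_self j⟩ :=
    measurable_pi_apply _
  have hψ : Measurable fun x : T → ℝ => F (∑ k : T, a k * x k) :=
    hF.measurable.comp (Finset.measurable_fun_sum _ fun k _ => by fun_prop)
  have hind := (h.indep.indepFun_finset {j} T (by simpa using hj) h.measurable).comp hφ hψ
  have e : ∀ ω, ∑ k ∈ T, a k * w k ω = ∑ k : T, a k * w k ω :=
    fun ω => (Finset.sum_coe_sort T fun k => a k * w k ω).symm
  have hI := hind.integral_mul_eq_mul_integral (h.measurable j).aestronglyMeasurable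
    (by
      have := (h.integrable_comp_sum a T hF).aestronglyMeasurable
      simpa only [e, Function.comp_def] using this)
  have h0 := h.integral_comp j id
  simp only [id] at h0
  simp only [e]
  refine Eq.trans hI ?_
  simp only [Function.comp_def]
  rw [h0]
  simp

/-- Induction on the index set: as `w_j² = 1`, expanding the power leaves terms free of `w_j` and
terms linear in it, and the latter have mean zero by independence. The constant `3` matches the
coefficient `6` of the cross term. -/
lemma integral_sum_sq_and_sum_pow_four [Countable ι] [IsProbabilityMeasure μ] (h : IsRademacherFamily μ w)
    (T : Finset ι) :
    ∫ ω, (∑ k ∈ T, a k * w k ω) ^ 2 ∂μ = ∑ k ∈ T, a k ^ 2 ∧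
      ∫ ω, (∑ k ∈ T, a k * w k ω) ^ 4 ∂μ ≤ 3 * (∑ k ∈ T, a k ^ 2) ^ 2 := by
  classical
  induction T using Finset.induction_on with
  | empty => simp
  | insert j T hj ih =>
    obtain ⟨ih2, ih4⟩ := ih
    have hI2 := h.integrable_comp_sum a T (F := fun x => x ^ 2) (by fun_prop)
    have hI4 := h.integrable_comp_sum a T (F := fun x => x ^ 4) (by fun_prop)
    have hbdd : ∀ F : ℝ → ℝ, Continuous F →
        Integrable (fun ω => w j ω * F (∑ k ∈ T, a k * w k ω)) μ := by
      intro F hF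
      refine (h.integrable_comp_sum a T hF).bdd_mul (c := 1)
        (h.measurable j).aestronglyMeasurable ?_
      filter_upwards [h.ae_eq_or_eq j] with ω hω
      rcases hω with e | e <;> simp [e]
    have e2 : (fun ω => (∑ k ∈ insert j T, a k * w k ω) ^ 2) =ᵐ[μ] fun ω =>
        a j ^ 2 + (∑ k ∈ T, a k * w k ω) ^ 2 +
          w j ω * (fun x => 2 * a j * x) (∑ k ∈ T, a k * w k ω) := by
      filter_upwards [h.ae_eq_or_eq j] with ω hω
      rw [Finset.sum_insert hj]
      rcases hω with e | e <;> rw [e] <;> ring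
    have e4 : (fun ω => (∑ k ∈ insert j T, a k * w k ω) ^ 4) =ᵐ[μ] fun ω =>
        a j ^ 4 + 6 * a j ^ 2 * (∑ k ∈ T, a k * w k ω) ^ 2 + (∑ k ∈ T, a k * w k ω) ^ 4 +
          w j ω * (fun x => 4 * a j * x ^ 3 + 4 * a j ^ 3 * x) (∑ k ∈ T, a k * w k ω) := by
      filter_upwards [h.ae_eq_or_eq j] with ω hω
      rw [Finset.sum_insert hj]
      rcases hω with e | e <;> rw [e] <;> ring
    rw [Finset.sum_insert hj]
    constructor
    · rw [integral_congr_ae e2, integral_add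
        (h.integrable_comp_sum a T (F := fun x => a j ^ 2 + x ^ 2) (by fun_prop))
        (hbdd (fun x => 2 * a j * x) (by fun_prop)),
        h.integral_mul_comp_sum_eq_zero a hj (F := fun x => 2 * a j * x) (by fun_prop),
        integral_add (integrable_const _) hI2, ih2]
      simp
    · rw [integral_congr_ae e4, integral_add
        (h.integrable_comp_sum a T (F := fun x => a j ^ 4 + 6 * a j ^ 2 * x ^ 2 + x ^ 4)
          (by fun_prop))
        (hbdd (fun x => 4 * a j * x ^ 3 + 4 * a j ^ 3 * x) (by fun_prop)),
        h.integral_mul_comp_sum_eq_zero a hj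
          (F := fun x => 4 * a j * x ^ 3 + 4 * a j ^ 3 * x) (by fun_prop),
        integral_add (h.integrable_comp_sum a T (F := fun x => a j ^ 4 + 6 * a j ^ 2 * x ^ 2)
          (by fun_prop)) hI4,
        integral_add (integrable_const _) (hI2.const_mul _), integral_const_mul, ih2]
      simp only [integral_const, probReal_univ, one_smul]
      nlinarith [sq_nonneg (a j ^ 2)]

end IsRademacherFamily

lemma exp_neg_le_one_sub_add_sq {y : ℝ} (hy : 0 ≤ y) : Real.exp (-y) ≤ 1 - y + y ^ 2 / 2 := by
  have h := Real.quadratic_le_exp_of_nonneg hy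
  have h1 : 0 < 1 + y + y ^ 2 / 2 := by positivity
  rw [Real.exp_neg]
  refine (inv_anti₀ h1 h).trans ?_
  rw [inv_le_iff_one_le_mul₀ h1]
  -- `(1 + y + y²/2)(1 - y + y²/2) = 1 + y⁴/4`.
  nlinarith [sq_nonneg (y ^ 2)]

/-- Jensen for `exp`; it spares any independence between the eigen-coordinates of a single sample.
-/
lemma exp_mul_sum_mul_le {κ : Type*} [Fintype κ] {p : κ → ℝ} (hp : ∀ i, 0 ≤ p i)
    (hp1 : ∑ i, p i = 1) (t : ℝ) (y : κ → ℝ) :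
    Real.exp (t * ∑ i, p i * y i) ≤ ∑ i, p i * Real.exp (t * y i) := by
  have := convexOn_exp.map_sum_le (t := Finset.univ) (w := p)
    (p := fun i => t * y i) (fun i _ => hp i) hp1 (fun _ _ => trivial)
  simp only [smul_eq_mul] at this
  refine le_trans (le_of_eq ?_) this
  simp only [Finset.mul_sum]
  congr 1
  exact Finset.sum_congr rfl fun _ _ => by ring

lemma lintegral_exp_mul_sq_gaussianReal {t : ℝ} (ht : t < 1 / 2) :
    ∫⁻ g, ENNReal.ofReal (Real.exp (t * g ^ 2)) ∂(gaussianReal 0 1) =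
      ENNReal.ofReal (√(1 - 2 * t))⁻¹ := by
  have hb : 0 < 1 / 2 - t := by linarith
  rw [gaussianReal_of_var_ne_zero 0 one_ne_zero, lintegral_withDensity_eq_lintegral_mul _
    (measurable_gaussianPDF 0 1) (by fun_prop)]
  have e : ∀ g : ℝ, (gaussianPDF 0 1 * fun g => ENNReal.ofReal (Real.exp (t * g ^ 2))) g =
      ENNReal.ofReal ((√(2 * Real.pi))⁻¹ * Real.exp (-(1 / 2 - t) * g ^ 2)) := by
    intro g
    rw [Pi.mul_apply, gaussianPDF, gaussianPDFReal, ← ENNReal.ofReal_mul (by positivity), mul_assoc,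
      ← Real.exp_add]
    congr 3
    · simp
    · simp
      ring
  simp only [e]
  rw [← ofReal_integral_eq_lintegral_ofReal ((integrable_exp_neg_mul_sq hb).const_mul _)
    (Filter.Eventually.of_forall fun _ => by positivity), integral_const_mul, integral_gaussian,
    ← Real.sqrt_inv, ← Real.sqrt_inv, ← Real.sqrt_mul (by positivity)]
  congr 2
  have : (1 - 2 * t) ≠ 0 := by linarith
  have : (1 / 2 - t) ≠ 0 := hb.ne'
  field_simp

namespace IsRademacherFamily

variable {w : ι → Ω → ℝ} [Fintype ι] [IsProbabilityMeasure μ] {a : ι → ℝ}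

/-- The moment generating function of the square of a Rademacher average is at most that of the
square of a standard Gaussian. -/
lemma integral_exp_mul_sum_sq_le (h : IsRademacherFamily μ w) (ha : ∑ k, a k ^ 2 = 1) {t : ℝ}
    (ht0 : 0 ≤ t) (ht : t < 1 / 2) :
    ∫ ω, Real.exp (t * (∑ k, a k * w k ω) ^ 2) ∂μ ≤ (√(1 - 2 * t))⁻¹ := by
  have hmeas := h.measurable_sum a Finset.univ
  have hgauss : ∀ c : ℝ, ENNReal.ofReal (Real.exp (c ^ 2 / 2)) =
      ∫⁻ g, ENNReal.ofReal (Real.exp (c * g)) ∂(gaussianReal 0 1) := by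
    intro c
    rw [← ofReal_integral_eq_lintegral_ofReal (integrable_exp_mul_gaussianReal c)
      (Filter.Eventually.of_forall fun _ => (Real.exp_pos _).le)]
    have := congrFun (mgf_id_gaussianReal (μ := 0) (v := 1)) c
    simp only [mgf, id] at this
    rw [this]
    simp
  have hc : √(2 * t) ^ 2 = 2 * t := Real.sq_sqrt (by linarith)
  have hle : ∫⁻ ω, ENNReal.ofReal (Real.exp (t * (∑ k, a k * w k ω) ^ 2)) ∂μ ≤
      ENNReal.ofReal (√(1 - 2 * t))⁻¹ := by
    -- An auxiliary Gaussian `g` linearizes the square: `exp (t S²) = E exp (√(2t) S g)`. After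
    -- Tonelli, the sub-Gaussian bound in `S` leaves `E exp (t g²)`.
    calc _ = ∫⁻ ω, ∫⁻ g, ENNReal.ofReal (Real.exp (√(2 * t) * (∑ k, a k * w k ω) * g))
              ∂(gaussianReal 0 1) ∂μ := by
          refine lintegral_congr fun ω => ?_
          rw [← hgauss, mul_pow, hc]
          congr 2
          ring
      _ = ∫⁻ g, ∫⁻ ω, ENNReal.ofReal (Real.exp (√(2 * t) * (∑ k, a k * w k ω) * g))
              ∂μ ∂(gaussianReal 0 1) := by
          rw [lintegral_lintegral_swap]
          have h1 : Measurable fun p : Ω × ℝ => ∑ k, a k * w k p.1 := hmeas.comp measurable_fst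
          exact (ENNReal.measurable_ofReal.comp (Real.measurable_exp.comp
            ((h1.const_mul _).mul measurable_snd))).aemeasurable
      _ ≤ ∫⁻ g, ENNReal.ofReal (Real.exp (t * g ^ 2)) ∂(gaussianReal 0 1) := by
          refine lintegral_mono fun g => ?_
          have hexp := h.integral_exp_mul_sum_le a (√(2 * t) * g)
          rw [ha, mul_pow, hc] at hexp
          rw [← ofReal_integral_eq_lintegral_ofReal
            (h.integrable_comp_sum a Finset.univ (F := fun x => Real.exp (√(2 * t) * x * g))
              (by fun_prop)) (Filter.Eventually.of_forall fun _ => (Real.exp_pos _).le)]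
          refine ENNReal.ofReal_le_ofReal ?_
          convert! hexp using 2
          · ext ω
            ring_nf
          · ring
      _ = _ := lintegral_exp_mul_sq_gaussianReal ht
  rw [integral_eq_lintegral_of_nonneg_ae (Filter.Eventually.of_forall fun _ => (Real.exp_pos _).le)
    (h.integrable_comp_sum a Finset.univ (F := fun x => Real.exp (t * x ^ 2))
      (by fun_prop)).aestronglyMeasurable]
  exact ENNReal.toReal_le_of_le_ofReal (by positivity) hle

lemma integral_exp_neg_mul_sum_sq_le (h : IsRademacherFamily μ w) (ha : ∑ k, a k ^ 2 = 1) {t : ℝ}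
    (ht : 0 ≤ t) :
    ∫ ω, Real.exp (-t * (∑ k, a k * w k ω) ^ 2) ∂μ ≤ Real.exp (-t + 3 / 2 * t ^ 2) := by
  obtain ⟨h2, h4⟩ := h.integral_sum_sq_and_sum_pow_four a Finset.univ
  rw [ha] at h2 h4
  have i2 := h.integrable_comp_sum a Finset.univ (F := fun x => x ^ 2) (by fun_prop)
  have i4 := h.integrable_comp_sum a Finset.univ (F := fun x => x ^ 4) (by fun_prop)
  calc _ ≤ ∫ ω, (1 - t * (∑ k, a k * w k ω) ^ 2 + t ^ 2 / 2 * (∑ k, a k * w k ω) ^ 4) ∂μ := by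
        refine integral_mono (h.integrable_comp_sum a Finset.univ
          (F := fun x => Real.exp (-t * x ^ 2)) (by fun_prop))
          (((integrable_const _).sub (i2.const_mul t)).add (i4.const_mul _)) fun ω => ?_
        have := exp_neg_le_one_sub_add_sq (mul_nonneg ht (sq_nonneg (∑ k, a k * w k ω)))
        rw [← neg_mul] at this
        refine this.trans (le_of_eq ?_)
        ring
    _ = 1 - t + t ^ 2 / 2 * ∫ ω, (∑ k, a k * w k ω) ^ 4 ∂μ := by
        rw [integral_add (h.integrable_comp_sum a Finset.univ (F := fun x => 1 - t * x ^ 2)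
          (by fun_prop)) (i4.const_mul _), integral_sub (integrable_const _) (i2.const_mul t), integral_const_mul,
          integral_const_mul, h2]
        simp
    _ ≤ (-t + 3 / 2 * t ^ 2) + 1 := by nlinarith [sq_nonneg t]
    _ ≤ _ := Real.add_one_le_exp _

/-- By convexity, the moment generating function of a quadratic form of trace one is controlled
by those of the squares of its eigen-coordinates. -/
lemma mgf_quadraticForm_le {κ : Type*} [Fintype κ] (h : IsRademacherFamily μ w) {p : κ → ℝ}
    {b : κ → ι → ℝ} (hp : ∀ i, 0 ≤ p i) (hp1 : ∑ i, p i = 1) {t E : ℝ}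
    (hE : ∀ i, ∫ ω, Real.exp (t * (∑ k, b i k * w k ω) ^ 2) ∂μ ≤ E) :
    mgf (fun ω => ∑ i, p i * (∑ k, b i k * w k ω) ^ 2) μ t ≤ E := by
  have hi : ∀ i, Integrable (fun ω => Real.exp (t * (∑ k, b i k * w k ω) ^ 2)) μ := fun i =>
    h.integrable_comp_sum (b i) Finset.univ (F := fun x => Real.exp (t * x ^ 2)) (by fun_prop)
  calc _ ≤ ∫ ω, ∑ i, p i * Real.exp (t * (∑ k, b i k * w k ω) ^ 2) ∂μ := by
        refine integral_mono_of_nonneg (Filter.Eventually.of_forall fun _ => (Real.exp_pos _).le)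
          (integrable_finsetSum _ fun i _ => (hi i).const_mul _)
          (Filter.Eventually.of_forall fun ω => ?_)
        exact exp_mul_sum_mul_le hp hp1 t _
    _ = ∑ i, p i * ∫ ω, Real.exp (t * (∑ k, b i k * w k ω) ^ 2) ∂μ := by
        rw [integral_finsetSum _ fun i _ => (hi i).const_mul _]
        simp only [integral_const_mul]
    _ ≤ ∑ i, p i * E := Finset.sum_le_sum fun i _ => mul_le_mul_of_nonneg_left (hE i) (hp i)
    _ = E := by rw [← Finset.sum_mul, hp1, one_mul]

end IsRademacherFamily

lemma measurable_quadraticForm {κ : Type*} [Fintype κ] [Fintype ι] {w : ι → Ω → ℝ}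
    (hw : ∀ k, Measurable (w k)) (p : κ → ℝ) (b : κ → ι → ℝ) :
    Measurable fun ω => ∑ i, p i * (∑ k, b i k * w k ω) ^ 2 := by
  fun_prop

lemma IsRademacherFamily.integrable_exp_mul_quadraticForm {κ : Type*} [Fintype κ] [Fintype ι]
    [IsProbabilityMeasure μ] {w : ι → Ω → ℝ} (h : IsRademacherFamily μ w) {p : κ → ℝ}
    (b : κ → ι → ℝ) (hp : ∀ i, 0 ≤ p i) (hp1 : ∑ i, p i = 1) (t : ℝ) :
    Integrable (fun ω => Real.exp (t * ∑ i, p i * (∑ k, b i k * w k ω) ^ 2)) μ := by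
  have hi : ∀ i, Integrable (fun ω => Real.exp (t * (∑ k, b i k * w k ω) ^ 2)) μ := fun i =>
    h.integrable_comp_sum (b i) Finset.univ (F := fun x => Real.exp (t * x ^ 2)) (by fun_prop)
  refine (integrable_finsetSum Finset.univ fun i _ => (hi i).const_mul (p i)).mono'
    ((measurable_quadraticForm h.measurable p b).const_mul t).exp.aestronglyMeasurable
    (Filter.Eventually.of_forall fun ω => ?_)
  rw [Real.norm_of_nonneg (Real.exp_pos _).le]
  exact exp_mul_sum_mul_le hp hp1 t _

/-- A doubly indexed independent family is independent as a family of families. -/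
lemma iIndepFun_curry [IsProbabilityMeasure μ] {κ : Type*} {X : ι → κ → Ω → ℝ}
    (mX : ∀ i j, Measurable (X i j)) (h : iIndepFun (fun (p : ι × κ) ω => X p.1 p.2 ω) μ) :
    iIndepFun (fun i ω j => X i j ω) μ := by
  have hs : iIndepFun (fun (p : (_ : ι) × κ) ω => X p.1 p.2 ω) μ :=
    h.precomp (Equiv.sigmaEquivProd ι κ).injective
  have hp : ∀ i j, IsProbabilityMeasure (μ.map (X i j)) :=
    fun i j => Measure.isProbabilityMeasure_map (mX i j).aemeasurable
  have hc : (MeasurableEquiv.piCurry fun (_ : ι) (_ : κ) => ℝ) ∘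
      (fun ω (p : (_ : ι) × κ) => X p.1 p.2 ω) = fun ω i j => X i j ω := by
    ext
    simp [Sigma.curry]
  -- Independence means that the joint law is a product; currying carries the product over pairs to
  -- a product of products.
  rw [iIndepFun_iff_map_fun_eq_infinitePi_map (by fun_prop), ← hc,
    ← Measure.map_map (by fun_prop) (by fun_prop),
    (iIndepFun_iff_map_fun_eq_infinitePi_map (by fun_prop)).1 hs,
    Measure.infinitePi_map_piCurry fun i j => μ.map (X i j)]
  congr 1
  ext1 i
  have hi : iIndepFun (X i) μ := h.precomp (g := fun j => (i, j)) fun _ _ e => (Prod.ext_iff.1 e).2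
  rw [(iIndepFun_iff_map_fun_eq_infinitePi_map (by fun_prop)).1 hi]

end Rademacher

/-! ### Chernoff bounds for the trace estimator -/

section Tail

variable {Ω : Type*} [MeasurableSpace Ω] {μ : Measure Ω} {m d : ℕ}
  {v : Fin m → Ω → Fin d → ℝ}

lemma IsRademacherSample.isRademacherFamily (hv : IsRademacherSample μ v) (s : Fin m) :
    IsRademacherFamily μ fun k ω => v s ω k where
  measurable := hv.1 s
  indep := hv.2.1.precomp (g := fun k => (s, k)) fun _ _ e => (Prod.ext_iff.1 e).2
  measure_one k := (hv.2.2 s k).1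
  measure_neg_one k := (hv.2.2 s k).2

variable [IsProbabilityMeasure μ]

lemma IsRademacherSample.iIndepFun_quadraticForm (hv : IsRademacherSample μ v) {κ : Type*}
    [Fintype κ] (p : κ → ℝ) (b : κ → Fin d → ℝ) :
    iIndepFun (fun s ω => ∑ i, p i * (∑ k, b i k * v s ω k) ^ 2) μ :=
  (iIndepFun_curry (X := fun s k ω => v s ω k) hv.1 hv.2.1).comp
    (fun _ x => ∑ i, p i * (∑ k, b i k * x k) ^ 2) fun _ => by fun_prop

variable {κ : Type*} [Fintype κ] {p : κ → ℝ} {b : κ → Fin d → ℝ} {η : ℝ}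

lemma IsRademacherSample.mgf_sum_le (hv : IsRademacherSample μ v) {t E : ℝ}
    (hE : ∀ s, mgf (fun ω => ∑ i, p i * (∑ k, b i k * v s ω k) ^ 2) μ t ≤ E) :
    mgf (∑ s, fun ω => ∑ i, p i * (∑ k, b i k * v s ω k) ^ 2) μ t ≤ E ^ m := by
  rw [(hv.iIndepFun_quadraticForm p b).mgf_sum
    (fun s => measurable_quadraticForm (hv.1 s) p b)]
  refine (Finset.prod_le_prod (fun s _ => mgf_nonneg) fun s _ => hE s).trans (le_of_eq ?_)
  simp

lemma one_add_le_exp_sub_sq_div_three (hη0 : 0 ≤ η) (hη : η ≤ 1 / 3) :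
    1 + η ≤ Real.exp (η - η ^ 2 / 3) := by
  refine le_trans ?_ (Real.quadratic_le_exp_of_nonneg (by nlinarith))
  have h : 8 / 9 ≤ 1 - η / 3 := by linarith
  have h2 : 2 / 3 ≤ (1 - η / 3) ^ 2 := by nlinarith
  have : (η - η ^ 2 / 3) ^ 2 = η ^ 2 * (1 - η / 3) ^ 2 := by ring
  nlinarith [mul_le_mul_of_nonneg_left h2 (sq_nonneg η)]

lemma IsRademacherSample.integrable_exp_mul_sum (hv : IsRademacherSample μ v)
    (hp : ∀ i, 0 ≤ p i) (hp1 : ∑ i, p i = 1) (t : ℝ) :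
    Integrable (fun ω =>
      Real.exp (t * (∑ s, fun ω => ∑ i, p i * (∑ k, b i k * v s ω k) ^ 2) ω)) μ :=
  (hv.iIndepFun_quadraticForm p b).integrable_exp_mul_sum
    (fun s => measurable_quadraticForm (hv.1 s) p b)
    fun s _ => (hv.isRademacherFamily s).integrable_exp_mul_quadraticForm b hp hp1 t

lemma IsRademacherSample.measureReal_ge_le (hv : IsRademacherSample μ v)
    (hp : ∀ i, 0 ≤ p i) (hp1 : ∑ i, p i = 1) (hb : ∀ i, ∑ k, b i k ^ 2 = 1)
    (hη0 : 0 < η) (hη : η ≤ 1 / 3) :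
    μ.real {ω | m * (1 + η) ≤ ∑ s, ∑ i, p i * (∑ k, b i k * v s ω k) ^ 2} ≤
      Real.exp (-(m * η ^ 2 / 6)) := by
  have h1 : 0 < 1 + η := by linarith
  -- The minimizer of the Gaussian Chernoff bound; it gives `1 - 2t = 1/(1+η)`.
  set t := η / (2 * (1 + η)) with ht
  have ht0 : 0 ≤ t := by positivity
  have ht2 : 1 - 2 * t = (1 + η)⁻¹ := by rw [ht]; field_simp; ring
  have hthalf : t < 1 / 2 := by
    have : 0 < (1 + η)⁻¹ := by positivity
    linarith
  have hmgf := hv.mgf_sum_le (p := p) (b := b) (t := t) (E := √(1 + η)) fun s => by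
    refine (hv.isRademacherFamily s).mgf_quadraticForm_le hp hp1 fun i => ?_
    have := (hv.isRademacherFamily s).integral_exp_mul_sum_sq_le (hb i) ht0 hthalf
    rwa [ht2, Real.sqrt_inv, inv_inv] at this
  have hE : √(1 + η) ≤ Real.exp (η / 2 - η ^ 2 / 6) := by
    refine Real.sqrt_le_iff.2 ⟨(Real.exp_pos _).le, ?_⟩
    rw [← Real.exp_nat_mul]
    refine (one_add_le_exp_sub_sq_div_three hη0.le hη).trans (le_of_eq ?_)
    congr 1
    push_cast
    ring
  have := measure_ge_le_exp_mul_mgf (m * (1 + η)) ht0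
    (hv.integrable_exp_mul_sum (b := b) hp hp1 t)
  simp only [Finset.sum_apply] at this
  refine this.trans ((mul_le_mul_of_nonneg_left (hmgf.trans
    (pow_le_pow_left₀ (Real.sqrt_nonneg _) hE m)) (Real.exp_pos _).le).trans (le_of_eq ?_))
  rw [← Real.exp_nat_mul, ← Real.exp_add]
  congr 1
  rw [ht]
  field_simp
  ring

lemma IsRademacherSample.measureReal_le_le (hv : IsRademacherSample μ v)
    (hp : ∀ i, 0 ≤ p i) (hp1 : ∑ i, p i = 1) (hb : ∀ i, ∑ k, b i k ^ 2 = 1) (hη0 : 0 < η) :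
    μ.real {ω | ∑ s, ∑ i, p i * (∑ k, b i k * v s ω k) ^ 2 ≤ m * (1 - η)} ≤
      Real.exp (-(m * η ^ 2 / 6)) := by
  -- `η/3` minimizes the exponent `-tη + (3/2)t²`, with value `-η²/6`.
  have hmgf := hv.mgf_sum_le (p := p) (b := b) (t := -(η / 3))
    (E := Real.exp (-(η / 3) + 3 / 2 * (η / 3) ^ 2)) fun s =>
    (hv.isRademacherFamily s).mgf_quadraticForm_le hp hp1 fun i =>
      (hv.isRademacherFamily s).integral_exp_neg_mul_sum_sq_le (hb i) (by positivity)
  have := measure_le_le_exp_mul_mgf (m * (1 - η)) (by linarith : -(η / 3) ≤ 0)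
    (hv.integrable_exp_mul_sum (b := b) hp hp1 _)
  simp only [Finset.sum_apply] at this
  refine this.trans ((mul_le_mul_of_nonneg_left hmgf (Real.exp_pos _).le).trans (le_of_eq ?_))
  rw [← Real.exp_nat_mul, ← Real.exp_add]
  congr 1
  ring

/-- Concentration of the Hutchinson estimator of the trace `∑ i, q i` of a positive semidefinite
matrix with eigenvalues `q i` and unit eigenvectors `b i`. -/
lemma IsRademacherSample.trace_estimator (hv : IsRademacherSample μ v) {q : κ → ℝ}
    (hq : ∀ i, 0 ≤ q i) (hq0 : 0 < ∑ i, q i) (hb : ∀ i, ∑ k, b i k ^ 2 = 1) (hm : 0 < m)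
    (hη0 : 0 < η) (hη : η ≤ 1 / 3) :
    1 - 2 * Real.exp (-(m * η ^ 2 / 6)) ≤
      μ.real {ω | |(∑ s, ∑ i, q i * (∑ k, b i k * v s ω k) ^ 2) / m - ∑ i, q i| ≤
        η * ∑ i, q i} := by
  set τ := ∑ i, q i
  have hp : ∀ i, 0 ≤ q i / τ := fun i => div_nonneg (hq i) hq0.le
  have hp1 : ∑ i, q i / τ = 1 := by rw [← Finset.sum_div]; exact div_self hq0.ne'
  have hm' : (0 : ℝ) < m := by exact_mod_cast hm
  have hU := hv.measureReal_ge_le hp hp1 hb hη0 hη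
  have hL := hv.measureReal_le_le hp hp1 hb hη0
  set A := {ω | m * (1 + η) ≤ ∑ s, ∑ i, q i / τ * (∑ k, b i k * v s ω k) ^ 2}
  set C := {ω | ∑ s, ∑ i, q i / τ * (∑ k, b i k * v s ω k) ^ 2 ≤ m * (1 - η)}
  set G := {ω | |(∑ s, ∑ i, q i * (∑ k, b i k * v s ω k) ^ 2) / m - τ| ≤ η * τ}
  have hcov : (Set.univ : Set Ω) ⊆ G ∪ (A ∪ C) := by
    intro ω _
    by_contra hω
    simp only [Set.mem_union, not_or] at hω
    obtain ⟨hG, hA, hC⟩ := hω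
    apply hG
    have e : ∑ s, ∑ i, q i / τ * (∑ k, b i k * v s ω k) ^ 2 =
        (∑ s, ∑ i, q i * (∑ k, b i k * v s ω k) ^ 2) / τ := by
      simp only [Finset.sum_div]
      exact Finset.sum_congr rfl fun _ _ => Finset.sum_congr rfl fun _ _ => by ring
    have hA' := not_le.1 (show ¬ m * (1 + η) ≤ _ from hA)
    have hC' := not_le.1 (show ¬ _ ≤ m * (1 - η) from hC)
    rw [e, div_lt_iff₀ hq0] at hA'
    rw [e, lt_div_iff₀ hq0] at hC'
    rw [Set.mem_ofPred_eq, abs_le]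
    constructor
    · rw [le_sub_iff_add_le, le_div_iff₀ hm']
      linarith
    · rw [sub_le_iff_le_add, div_le_iff₀ hm']
      linarith
  have h1 : (1 : ℝ) ≤ μ.real (G ∪ (A ∪ C)) := by
    rw [← probReal_univ (μ := μ)]
    exact measureReal_mono hcov
  have h2 := measureReal_union_le (μ := μ) G (A ∪ C)
  have h3 := measureReal_union_le (μ := μ) A C
  linarith

end Tail

/-! ### The estimator in an eigenbasis of `B` -/

section LinearAlgebra

open Matrix

variable {d : ℕ}

/-- Pairing with a left eigenvector turns the vector recursion into the scalar Chebyshev recursion,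
so no polynomial of a matrix is needed. -/
lemma dotProduct_chebVec {X : Matrix (Fin d) (Fin d) ℝ} {u : Fin d → ℝ} {x : ℝ}
    (hu : ∀ z, u ⬝ᵥ X *ᵥ z = x * (u ⬝ᵥ z)) (z : Fin d → ℝ) (j : ℕ) :
    u ⬝ᵥ chebVec X z j = (Polynomial.Chebyshev.T ℝ (j : ℤ)).eval x * (u ⬝ᵥ z) := by
  induction j using Nat.twoStepInduction with
  | zero => simp [chebVec]
  | one => simp [chebVec, hu]
  | more j ih0 ih1 =>
    have : ((j + 2 : ℕ) : ℤ) = (j : ℤ) + 2 := by push_cast; ring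
    rw [chebVec, dotProduct_sub, dotProduct_smul, hu, ih1, ih0, this,
      Polynomial.Chebyshev.T_add_two]
    simp
    ring

lemma dotProduct_scaledMatrix_mulVec {δ : ℝ} {B : Matrix (Fin d) (Fin d) ℝ} {u : Fin d → ℝ}
    {l : ℝ} (hu : ∀ z, u ⬝ᵥ B *ᵥ z = l * (u ⬝ᵥ z)) (z : Fin d → ℝ) :
    u ⬝ᵥ scaledMatrix δ B *ᵥ z = (2 * (1 - l) - 1) / (1 - 2 * δ) * (u ⬝ᵥ z) := by
  rw [scaledMatrix, smul_mulVec, sub_mulVec, smul_mulVec, sub_mulVec, one_mulVec, dotProduct_smul,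
    dotProduct_sub, dotProduct_smul, dotProduct_sub, hu]
  simp only [smul_eq_mul]
  ring

variable {B : Matrix (Fin d) (Fin d) ℝ} (hB : B.IsHermitian)

lemma eigenvectorBasis_dotProduct_mulVec (i : Fin d) (z : Fin d → ℝ) :
    (hB.eigenvectorBasis i).ofLp ⬝ᵥ B *ᵥ z =
      hB.eigenvalues i * ((hB.eigenvectorBasis i).ofLp ⬝ᵥ z) := by
  rw [dotProduct_mulVec, ← mulVec_transpose, ← conjTranspose_eq_transpose_of_trivial, hB.eq,
    hB.mulVec_eigenvectorBasis, smul_dotProduct, smul_eq_mul]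

lemma sum_eigenvectorBasis_sq (i : Fin d) : ∑ k, (hB.eigenvectorBasis i).ofLp k ^ 2 = 1 := by
  have := hB.eigenvectorBasis.orthonormal.1 i
  rw [EuclideanSpace.norm_eq, Real.sqrt_eq_one] at this
  simpa using this

lemma dotProduct_eq_sum_eigenvectorBasis (y z : Fin d → ℝ) :
    y ⬝ᵥ z = ∑ i, ((hB.eigenvectorBasis i).ofLp ⬝ᵥ y) * ((hB.eigenvectorBasis i).ofLp ⬝ᵥ z) := by
  have h := hB.eigenvectorBasis.sum_inner_mul_inner (WithLp.toLp 2 y) (WithLp.toLp 2 z)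
  simp only [EuclideanSpace.inner_eq_star_dotProduct, star_trivial] at h
  rw [dotProduct_comm, ← h]
  exact Finset.sum_congr rfl fun i _ => by rw [dotProduct_comm z]

/-- The image of the `i`-th eigenvalue of `B` in `[-1, 1]`. -/
noncomputable def scaledEigenvalue (δ : ℝ) (i : Fin d) : ℝ :=
  (2 * (1 - hB.eigenvalues i) - 1) / (1 - 2 * δ)

lemma logDetEstimate_eq (δ : ℝ) (n m : ℕ) (v : Fin m → Fin d → ℝ) :
    logDetEstimate δ B n m v = (∑ s, ∑ i, chebInterp (scaledLog δ) n (scaledEigenvalue hB δ i) *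
      (∑ k, (hB.eigenvectorBasis i).ofLp k * v s k) ^ 2) / m := by
  rw [logDetEstimate, ← Finset.sum_div]
  congr 1
  refine Finset.sum_congr rfl fun s _ => ?_
  rw [dotProduct_eq_sum_eigenvectorBasis hB]
  refine Finset.sum_congr rfl fun i _ => ?_
  rw [dotProduct_sum, chebInterp]
  simp only [dotProduct_smul, smul_eq_mul,
    dotProduct_chebVec (dotProduct_scaledMatrix_mulVec (eigenvectorBasis_dotProduct_mulVec hB i))]
  rw [Finset.mul_sum, Finset.sum_mul]
  refine Finset.sum_congr rfl fun j _ => ?_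
  simp only [scaledEigenvalue, dotProduct]
  ring

end LinearAlgebra

/-! ### Combining the two errors -/

section Main

variable {d : ℕ} {B : Matrix (Fin d) (Fin d) ℝ} {δ : ℝ}

lemma scaledLog_scaledEigenvalue (hB : B.IsHermitian) (hδ : δ ∈ Set.Ioo (0 : ℝ) (1 / 2))
    (i : Fin d) : scaledLog δ (scaledEigenvalue hB δ i) = Real.log (hB.eigenvalues i) := by
  have : 1 - 2 * δ ≠ 0 := by linarith [hδ.2]
  rw [scaledLog, scaledEigenvalue]
  congr 1
  field_simp
  ring

lemma abs_scaledEigenvalue_le_one (hB : B.IsHermitian) (hδ : δ ∈ Set.Ioo (0 : ℝ) (1 / 2))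
    {i : Fin d} (hi : hB.eigenvalues i ∈ Set.Icc δ (1 - δ)) : |scaledEigenvalue hB δ i| ≤ 1 := by
  have : 0 < 1 - 2 * δ := by linarith [hδ.2]
  rw [scaledEigenvalue, abs_le, le_div_iff₀ this, div_le_iff₀ this]
  constructor <;> linarith [hi.1, hi.2]

lemma log_one_div_one_sub_le_neg_log {l : ℝ} (hδ : δ ∈ Set.Ioo (0 : ℝ) (1 / 2))
    (hl : l ∈ Set.Icc δ (1 - δ)) : Real.log (1 / (1 - δ)) ≤ -Real.log l := by
  rw [one_div, Real.log_inv, neg_le_neg_iff]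
  exact Real.log_le_log (hδ.1.trans_le hl.1) hl.2

lemma log_det_eq_sum (hB : B.PosDef) :
    Real.log B.det = ∑ i, Real.log (hB.isHermitian.eigenvalues i) := by
  rw [hB.isHermitian.det_eq_prod_eigenvalues]
  exact Real.log_prod fun i _ => (hB.eigenvalues_pos i).ne'

/-- The deterministic part: an accurate trace estimate gives an accurate log-determinant. -/
lemma abs_log_det_sub_le {ε Γ : ℝ} (hε : ε ∈ Set.Ioo (0 : ℝ) 1)
    (hδ : δ ∈ Set.Ioo (0 : ℝ) (1 / 2)) (hB : B.PosDef)
    (hspec : ∀ i, hB.isHermitian.eigenvalues i ∈ Set.Icc δ (1 - δ)) {q : Fin d → ℝ}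
    (hq : ∀ i, |Real.log (hB.isHermitian.eigenvalues i) + q i| ≤
      ε / 6 * Real.log (1 / (1 - δ)))
    (hΓ : |-Γ - ∑ i, q i| ≤ ε / 3 * ∑ i, q i) :
    |Real.log B.det - Γ| ≤ ε * |Real.log B.det| := by
  rw [log_det_eq_sum hB]
  set D := ∑ i, Real.log (hB.isHermitian.eigenvalues i)
  have hlog : ∀ i, Real.log (1 / (1 - δ)) ≤ -Real.log (hB.isHermitian.eigenvalues i) :=
    fun i => log_one_div_one_sub_le_neg_log hδ (hspec i)
  have hL : 0 < Real.log (1 / (1 - δ)) := hδ.1.trans_le (le_log_one_div_one_sub hδ)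
  have hD : D ≤ 0 := Finset.sum_nonpos fun i _ => by linarith [hlog i]
  have hDq : |D + ∑ i, q i| ≤ ε / 6 * -D := by
    rw [← Finset.sum_add_distrib, ← Finset.sum_neg_distrib, Finset.mul_sum]
    refine (Finset.abs_sum_le_sum_abs _ _).trans (Finset.sum_le_sum fun i _ => (hq i).trans ?_)
    exact mul_le_mul_of_nonneg_left (hlog i) (by linarith [hε.1])
  rw [abs_of_nonpos hD]
  have hε0 := hε.1
  have hε1 := hε.2
  obtain ⟨h1, h2⟩ := abs_le.1 hDq
  obtain ⟨h3, h4⟩ := abs_le.1 hΓ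
  have h5 : ε / 6 * -D ≤ -D / 6 := by nlinarith
  -- The surrogate trace is at most `(7/6)|D|`, so the total error is at most `(1/6 + 7/18) ε |D| ≤
  -- ε |D|`.
  have h6 : ε / 3 * ∑ i, q i ≤ ε / 3 * (7 / 6 * -D) :=
    mul_le_mul_of_nonneg_left (by linarith) (by linarith)
  have h7 : 0 ≤ ε * -D := mul_nonneg hε0.le (by linarith)
  rw [abs_le]
  constructor <;> linarith

end Main

theorem theorem1 :
    (∀ {Ω : Type*} [MeasurableSpace Ω] (μ : Measure Ω) [IsProbabilityMeasure μ]
      (ε ζ δ : ℝ) (_ : ε ∈ Set.Ioo (0 : ℝ) 1) (_ : ζ ∈ Set.Ioo (0 : ℝ) 1)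
      (_ : δ ∈ Set.Ioo (0 : ℝ) (1 / 2))
      (d : ℕ) (B : Matrix (Fin d) (Fin d) ℝ) (_ : B.PosDef)
      (_ : spectrum ℝ B ⊆ Set.Icc δ (1 - δ))
      (m n : ℕ) (_ : 54 * (ε ^ 2)⁻¹ * Real.log (2 / ζ) ≤ (m : ℝ))
      (_ : degreeThreshold ε δ ≤ (n : ℝ))
      (v : Fin m → Ω → Fin d → ℝ) (_ : IsRademacherSample μ v),
      1 - ζ ≤ μ.real {ω | |Real.log B.det - logDetEstimate δ B n m (fun i => v i ω)|
        ≤ ε * |Real.log B.det|}) ∧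
    ∃ C : ℝ, 0 < C ∧ ∀ ε δ : ℝ, ε ∈ Set.Ioo (0 : ℝ) 1 → δ ∈ Set.Ioo (0 : ℝ) (1 / 2) →
      |degreeThreshold ε δ| ≤ C * (Real.sqrt (1 / δ) * Real.log (1 / (ε * δ))) := by
  refine ⟨?_, 10, by norm_num, fun ε δ hε hδ => abs_degreeThreshold_le hε hδ⟩
  intro Ω _ μ _ ε ζ δ hε hζ hδ d B hB hspec m n hm hn v hv
  -- For `d = 0` the trace is not positive, but both quantities are zero.
  rcases Nat.eq_zero_or_pos d with rfl | hd
  · have : ∀ w, logDetEstimate δ B n m w = 0 := fun w => by simp [logDetEstimate]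
    simp [this, hζ.1.le]
  have hε0 := hε.1
  have hζ0 := hζ.1
  have hlogζ : 0 < Real.log (2 / ζ) := by
    refine Real.log_pos ?_
    rw [one_lt_div hζ0]
    linarith [hζ.2]
  have hm0 : 0 < m := by
    have : (0 : ℝ) < m := lt_of_lt_of_le (by positivity) hm
    exact_mod_cast this
  have hH := hB.isHermitian
  have hev : ∀ i, hH.eigenvalues i ∈ Set.Icc δ (1 - δ) :=
    fun i => hspec (hH.eigenvalues_mem_spectrum_real i)
  -- The sign is flipped because the logarithms are negative and the concentration bound needs
  -- nonnegative weights.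
  set q : Fin d → ℝ := fun i => -chebInterp (scaledLog δ) n (scaledEigenvalue hH δ i) with hqdef
  have hq : ∀ i, |Real.log (hH.eigenvalues i) + q i| ≤ ε / 6 * Real.log (1 / (1 - δ)) := by
    intro i
    rw [← scaledLog_scaledEigenvalue hH hδ i]
    exact abs_scaledLog_sub_chebInterp_le_of_degreeThreshold_le hε hδ
      (abs_scaledEigenvalue_le_one hH hδ (hev i)) hn
  have hL : 0 < Real.log (1 / (1 - δ)) := hδ.1.trans_le (le_log_one_div_one_sub hδ)
  have hqpos : ∀ i, 0 < q i := by
    intro i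
    have h1 := (abs_le.1 (hq i)).1
    have h2 := log_one_div_one_sub_le_neg_log hδ (hev i)
    nlinarith [hε.2]
  have : Nonempty (Fin d) := ⟨⟨0, hd⟩⟩
  have htrace := hv.trace_estimator (η := ε / 3) (fun i => (hqpos i).le)
    (Finset.sum_pos (fun i _ => hqpos i) Finset.univ_nonempty) (sum_eigenvectorBasis_sq hH) hm0
    (by positivity) (by linarith [hε.2])
  -- The constant `54` is `6 · 3²`: `6` from the tail exponent, `3²` from the accuracy `ε/3`.
  have hexp : 2 * Real.exp (-(m * (ε / 3) ^ 2 / 6)) ≤ ζ := by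
    have h1 : Real.log (2 / ζ) ≤ m * (ε / 3) ^ 2 / 6 := by
      have h2 : 54 * Real.log (2 / ζ) ≤ m * ε ^ 2 := by
        rw [mul_right_comm, ← div_eq_mul_inv, div_le_iff₀ (by positivity)] at hm
        exact hm
      linarith
    calc _ ≤ 2 * Real.exp (-Real.log (2 / ζ)) := by gcongr
      _ = ζ := by
        rw [Real.exp_neg, Real.exp_log (by positivity)]
        field_simp
  refine (by linarith : 1 - ζ ≤ 1 - 2 * Real.exp (-(m * (ε / 3) ^ 2 / 6))).trans
    (htrace.trans (measureReal_mono fun ω hω => ?_))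
  refine abs_log_det_sub_le hε hδ hB hev hq ?_
  have hω' : |(∑ s, ∑ i, q i * (∑ k, (hH.eigenvectorBasis i).ofLp k * v s ω k) ^ 2) / m
      - ∑ i, q i| ≤ ε / 3 * ∑ i, q i := hω
  rw [logDetEstimate_eq hH]
  convert! hω' using 3
  rw [← neg_div, ← Finset.sum_neg_distrib]
  congr 1
  refine Finset.sum_congr rfl fun s _ => ?_
  rw [← Finset.sum_neg_distrib]
  exact Finset.sum_congr rfl fun i _ => by rw [hqdef]; ring
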